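/- Let $X=\mathbb{R}^K$ with the Euclidean norm, $N\ge 1$, $I=\{1,\dots,N\}$, and let $\Phi_1,\dots,\Phi_N\in C^1(X;\mathbb{R})$ have Lipschitz gradients with common constant $L$ and be strongly convex with constant $\kappa>0$, i.e. $\langle x-y,\nabla\Phi_j(x)-\nabla\Phi_j(y)\rangle\ge\kappa\|x-y\|^2$ for all $x,y\in X$, $j\in I$. Let $\gamma>0$ and let $(i(t))_{t\ge0}$ be a càdlàg continuous-time Markov process on $I$, defined on a probability space $(\Omega,\mathcal F,\mathbb P)$, with uniform initial distribution and transition rate matrix $\mathbf{\Gamma}_N-N\gamma\mathbf{I}_N$, where all entries of the $N\times N$ matrix $\mathbf{\Gamma}_N$ equal $\gamma$ and $\mathbf{I}_N$ is the identity matrix. Let $\mu:[0,\infty)\to(0,\infty)$ be non-decreasing and continuously differentiable, $\beta(t)=\int_0^t\mu(s)\,ds$, and $i^\beta(t)=i(\beta(t))$. Let $m:[0,\infty)\to(0,\infty)$ be strictly decreasing and differentiable with $m(t)\to0$ as $t\to\infty$, $m(0)\le1$, and $$|m'(t)|\le\lambda\,m(t)\quad\text{for all }t>0,\qquad \lambda=\min(\kappa/4,1/4).$$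 Let $\tau_0=0$, let $\tau_1<\tau_2<\cdots$ be the jump times of $(i(t))_{t\ge0}$, and put $\tau_n^\beta=\beta^{-1}(\tau_n)$. For $\alpha_1,\alpha_2,\alpha_3>0$ and $n\ge 1$ let $$\Omega_n^\alpha=\Big\{\frac{\kappa}{2\mu(\tau^\beta_{n+1})}\ge\frac{\alpha_1}{\sqrt n}\ \text{ and }\ m(\tau_n^\beta)\le\alpha_2e^{-\alpha_3\sqrt n}\Big\},$$ where a jump time that does not exist (as when $N=1$) imposes no condition. Assume that there exist $\alpha_1,\alpha_2,\alpha_3>0$ such that $$\lim_{k\to\infty}\mathbb P\Big(\bigcap_{n\ge k}\Omega_n^\alpha\Big)=1.$$ Let $q_0,p_0,\xi_0\in X$ and let $(q_t,p_t)_{t\ge0}$ and $(\xi_t)_{t\ge0}$ solve, almost surely and with the same index process, $$\begin{cases}dq_t=p_t\,dt,\\ m(t)\,dp_t=-\nabla\Phi_{i^\beta(t)}(q_t)\,dt-p_t\,dt,\end{cases}\qquad d\xi_t=-\nabla\Phi_{i^\beta(t)}(\xi_t)\,dt,$$ with initial values $q_0,p_0$ and $\xi_0$ at $t=0$. Then $$\|q_t-\xi_t\|\to0\quad\text{almost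 surely, as }t\to\infty.$$ -/

import Mathlib

open MeasureTheory Filter Topology Set
open scoped NNReal Gradient RealInnerProductSpace

noncomputable section

namespace SGMP

/-- The state space `X = ℝ^K` with its Euclidean norm. -/
abbrev X (K : ℕ) : Type := EuclideanSpace ℝ (Fin K)

/-- The transition rate matrix `Γ_N - N γ I_N`, where all entries of `Γ_N` equal `γ`. -/
def rateMatrix (N : ℕ) (γ : ℝ) : Matrix (Fin N) (Fin N) ℝ :=
  Matrix.of (fun _ _ => γ) - ((N : ℝ) * γ) • (1 : Matrix (Fin N) (Fin N) ℝ)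

/-- `(i(t))_{t ≥ 0}` is a càdlàg continuous-time Markov process on the index set with transition
rate matrix `rateMatrix N γ` and uniform initial distribution. The Markov property is stated
through the finite-dimensional distributions: given the values at times `t 0 ≤ ⋯ ≤ t n`, the
value at time `t (n+1)` has the law `exp ((t (n+1) - t n) A) (i (t n)) ·`. -/
structure IsIndexProcess {Ω : Type*} [MeasurableSpace Ω] (P : Measure Ω) {N : ℕ} (γ : ℝ)
    (i : ℝ → Ω → Fin N) : Prop where
  measurable : ∀ t, 0 ≤ t → Measurable (i t)
  right_continuous : ∀ ω, ∀ t, 0 ≤ t → ∀ᶠ s in 𝓝[>] t, i s ω = i t ω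
  left_limits : ∀ ω, ∀ t, 0 < t → ∃ j, ∀ᶠ s in 𝓝[<] t, i s ω = j
  initial : ∀ j, P.real {ω | i 0 ω = j} = 1 / (N : ℝ)
  markov : ∀ (n : ℕ) (t : ℕ → ℝ) (j : ℕ → Fin N), 0 ≤ t 0 → Monotone t →
    P.real {ω | ∀ k ≤ n + 1, i (t k) ω = j k} =
      P.real {ω | ∀ k ≤ n, i (t k) ω = j k} *
        NormedSpace.exp ((t (n + 1) - t n) • rateMatrix N γ) (j n) (j (n + 1))

/-- The jump times of a càdlàg path `x` on a finite set: `τ_0 = 0` and `τ_{n+1}` is the first time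
after `τ_n` at which the path leaves the state `x (τ_n)`; it is `⊤` if there is no such time. -/
def jumpTime {N : ℕ} (x : ℝ → Fin N) : ℕ → EReal
  | 0 => 0
  | n + 1 => sInf {s : EReal | ∃ t : ℝ, s = (t : EReal) ∧ jumpTime x n < s ∧
      x t ≠ x (jumpTime x n).toReal}

/-- `β(t) = ∫_0^t μ(s) ds`. -/
def beta (μ : ℝ → ℝ) (t : ℝ) : ℝ := ∫ s in (0 : ℝ)..t, μ s

/-- The inverse of `β : [0, ∞) → [0, ∞)`. -/
def betaInv (μ : ℝ → ℝ) : ℝ → ℝ := Function.invFunOn (beta μ) (Ici 0)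

/-- `μ : [0, ∞) → (0, ∞)` is non-decreasing and continuously differentiable. -/
structure IsRate (μ : ℝ → ℝ) : Prop where
  pos : ∀ t, 0 ≤ t → 0 < μ t
  monotone : MonotoneOn μ (Ici 0)
  contDiff : ContDiffOn ℝ 1 μ (Ici 0)

/-- `m : [0, ∞) → (0, ∞)` is differentiable and strictly decreasing with limit `0`. -/
structure IsMass (m : ℝ → ℝ) : Prop where
  pos : ∀ t, 0 ≤ t → 0 < m t
  strictAnti : StrictAntiOn m (Ici 0)
  differentiable : DifferentiableOn ℝ m (Ici 0)
  tendsto_zero : Tendsto m atTop (𝓝 0)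

/-- The mass decreases slowly: `|m'(t)| ≤ lam * m(t)` for `t > 0`, and `m(0) ≤ 1`. -/
structure SlowMass (m : ℝ → ℝ) (lam : ℝ) : Prop where
  initial : m 0 ≤ 1
  deriv_le : ∀ t, 0 < t → |deriv m t| ≤ lam * m t

/-- Strong convexity of a differentiable function, with constant `κ`. -/
def IsStronglyConvex {K : ℕ} (f : X K → ℝ) (κ : ℝ) : Prop :=
  0 < κ ∧ ∀ x y : X K, κ * ‖x - y‖ ^ 2 ≤ ⟪x - y, ∇ f x - ∇ f y⟫

/-- The event `κ / (2 μ(τ^β_{n+1})) ≥ α₁ / √n` and `m(τ^β_n) ≤ α₂ exp(-α₃ √n)`, where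
`τ^β_n = β⁻¹(τ_n)`. For `N ≥ 2` all jump times are almost surely finite; a jump time that does not
exist (as for `N = 1`) imposes no condition. -/
def growthEvent {Ω : Type*} {N : ℕ} (i : ℝ → Ω → Fin N) (m μ : ℝ → ℝ) (κ α₁ α₂ α₃ : ℝ)
    (n : ℕ) : Set Ω :=
  {ω | (jumpTime (fun t => i t ω) (n + 1) ≠ ⊤ →
          α₁ / √(n : ℝ) ≤ κ / (2 * μ (betaInv μ (jumpTime (fun t => i t ω) (n + 1)).toReal))) ∧
       (jumpTime (fun t => i t ω) n ≠ ⊤ →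
          m (betaInv μ (jumpTime (fun t => i t ω) n).toReal) ≤ α₂ * Real.exp (-α₃ * √(n : ℝ)))}

/-- For some `α₁, α₂, α₃ > 0`, the probability that `growthEvent … n` holds for all `n ≥ k`
tends to `1` as `k → ∞`. -/
def GrowthCondition {Ω : Type*} [MeasurableSpace Ω] (P : Measure Ω) {N : ℕ}
    (i : ℝ → Ω → Fin N) (m μ : ℝ → ℝ) (κ : ℝ) : Prop :=
  ∃ α₁ α₂ α₃ : ℝ, 0 < α₁ ∧ 0 < α₂ ∧ 0 < α₃ ∧
    Tendsto (fun k : ℕ => P (⋂ n ≥ k, growthEvent i m μ κ α₁ α₂ α₃ n)) atTop (𝓝 1)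

/-- `(q, p)` solves `dq = p dt`, `m(t) dp = -∇Φ_{x(t)}(q) dt - p dt` on `[0, ∞)` with
`q(0) = q₀`, `p(0) = p₀`, for a given path `x` of the indices. The path `x` jumps, so the equation
is understood in integrated form. -/
structure IsMomentumSolution {K N : ℕ} (Φ : Fin N → X K → ℝ) (m : ℝ → ℝ) (x : ℝ → Fin N)
    (q₀ p₀ : X K) (q p : ℝ → X K) : Prop where
  continuous_q : ContinuousOn q (Ici 0)
  continuous_p : ContinuousOn p (Ici 0)
  integrable : ∀ t, 0 ≤ t → IntervalIntegrable
    (fun s => (m s)⁻¹ • (-∇ (Φ (x s)) (q s) - p s)) volume 0 t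
  eq_q : ∀ t, 0 ≤ t → q t = q₀ + ∫ s in (0 : ℝ)..t, p s
  eq_p : ∀ t, 0 ≤ t → p t = p₀ + ∫ s in (0 : ℝ)..t, (m s)⁻¹ • (-∇ (Φ (x s)) (q s) - p s)

/-- `ξ` solves `dξ = -∇Φ_{x(t)}(ξ) dt` on `[0, ∞)` with `ξ(0) = ξ₀`, in integrated form, for a
given path `x` of the indices. -/
structure IsGradientSolution {K N : ℕ} (Φ : Fin N → X K → ℝ) (x : ℝ → Fin N)
    (ξ₀ : X K) (ξ : ℝ → X K) : Prop where
  continuous_ξ : ContinuousOn ξ (Ici 0)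
  integrable : ∀ t, 0 ≤ t → IntervalIntegrable (fun s => -∇ (Φ (x s)) (ξ s)) volume 0 t
  eq_ξ : ∀ t, 0 ≤ t → ξ t = ξ₀ + ∫ s in (0 : ℝ)..t, -∇ (Φ (x s)) (ξ s)

end SGMP

end

/-! The argument is deterministic, one index path at a time. Put y = q + m p. The friction term
cancels, so y' = m' p - ∇Φ(q). Since |m'| ≤ m and q = y - m p, this is the gradient flow at y up to
an error of norm at most (L+1) m‖p‖ (`inner_sub_gradient_le`). By strong monotonicity, ‖y - ξ‖²
decays at rate κ up to a forcing of order (m‖p‖)², so everything reduces to m‖p‖ → 0.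

For that, `lyapunov_estimate` shows that ‖y‖² + a m‖p‖² is dissipated up to a constant once m is
small. Hence m‖p‖² stays bounded, and (m‖p‖)² = m · (m‖p‖²) → 0. Index switching does no harm
because all the constants are uniform in the index; as paths jump, only right derivatives are used.
-/

namespace SGMP

/-! ### Differential inequalities for right derivatives -/

/-- Gronwall's inequality with a damping term. -/
lemma le_exp_of_rightDeriv_le {V V' : ℝ → ℝ} {T c D : ℝ} (hc : 0 < c) (hD : 0 ≤ D)
    (hV : ∀ t, T ≤ t → ContinuousWithinAt V (Ici T) t)
    (hV' : ∀ t, T ≤ t → HasDerivWithinAt V (V' t) (Ici t) t)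
    (hle : ∀ t, T ≤ t → V' t ≤ -c * V t + D) {t : ℝ} (ht : T ≤ t) :
    V t ≤ V T * Real.exp (-c * (t - T)) + D / c := by
  have h := le_gronwallBound_of_liminf_deriv_right_le (f := V) (f' := V') (δ := V T) (K := -c)
    (ε := D) (a := T) (b := t)
    (fun s hs => (hV s hs.1).mono fun _ hr => hr.1)
    (fun s hs r hr => (hV' s hs.1).liminf_right_slope_le hr) le_rfl
    (fun s hs => hle s hs.1) t ⟨ht, le_rfl⟩
  rw [gronwallBound_of_K_ne_0 (neg_ne_zero.2 hc.ne')] at h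
  have h1 : 0 ≤ D / c * Real.exp (-c * (t - T)) := by positivity
  have h2 : D / -c * (Real.exp (-c * (t - T)) - 1)
      = D / c - D / c * Real.exp (-c * (t - T)) := by
    rw [div_neg]; ring
  simp only [h2] at h
  linarith

/-- A nonnegative function with `V' ≤ -c V + δ`, where `δ` tends to zero, tends to zero. -/
lemma tendsto_zero_of_rightDeriv_le {V V' δ : ℝ → ℝ} {T c : ℝ} (hc : 0 < c)
    (hV : ∀ t, T ≤ t → ContinuousWithinAt V (Ici T) t)
    (hV' : ∀ t, T ≤ t → HasDerivWithinAt V (V' t) (Ici t) t)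
    (hle : ∀ t, T ≤ t → V' t ≤ -c * V t + δ t) (hδ : Tendsto δ atTop (𝓝 0))
    (hV0 : ∀ t, 0 ≤ V t) : Tendsto V atTop (𝓝 0) := by
  refine (Metric.tendsto_atTop'.2 fun ε hε => ?_)
  -- A forcing below c ε/2 leaves a residual level ε/2; the other half of ε absorbs the decaying
  -- exponential.
  obtain ⟨S, hS⟩ := eventually_atTop.1 (hδ.eventually (gt_mem_nhds
    (mul_pos hc (half_pos hε))))
  set R := max S T with hR
  have hTR : T ≤ R := le_max_right _ _
  have hexp : Tendsto (fun t => V R * Real.exp (-c * (t - R))) atTop (𝓝 0) := by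
    have h1 : Tendsto (fun t : ℝ => c * (t - R)) atTop atTop :=
      (tendsto_atTop_add_const_right atTop (-R) tendsto_id).const_mul_atTop hc
    have h2 := (Real.tendsto_exp_neg_atTop_nhds_zero.comp h1).const_mul (V R)
    simpa [Function.comp_def, neg_mul] using h2
  obtain ⟨Q, hQ⟩ := eventually_atTop.1 (hexp.eventually (gt_mem_nhds (half_pos hε)))
  refine ⟨max Q R, fun t ht => ?_⟩
  have htR : R ≤ t := (le_max_right _ _).trans ht.le
  have h := le_exp_of_rightDeriv_le (V := V) (V' := V') (T := R) (c := c) (D := c * (ε / 2)) hc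
    (by positivity)
    (fun s hs => (hV s (hTR.trans hs)).mono (Ici_subset_Ici.2 hTR))
    (fun s hs => hV' s (hTR.trans hs))
    (fun s hs => (hle s (hTR.trans hs)).trans
      (by linarith [hS s ((le_max_left _ _).trans hs)])) htR
  have h3 := hQ t ((le_max_left _ _).trans ht.le)
  have h4 : c * (ε / 2) / c = ε / 2 := by field_simp
  rw [Real.dist_eq, sub_zero, abs_of_nonneg (hV0 t)]
  linarith

/-- Right derivative of a function given as an integral of a right-continuous integrand. -/
lemma hasDerivWithinAt_Ici_of_eq_integral {E : Type*} [NormedAddCommGroup E] [NormedSpace ℝ E]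
    [CompleteSpace E] {f g : ℝ → E} {a : E}
    (hf : ∀ t, 0 ≤ t → IntervalIntegrable f volume 0 t)
    (hg : ∀ t, 0 ≤ t → g t = a + ∫ s in (0 : ℝ)..t, f s) {t : ℝ} (ht : 0 ≤ t)
    (hc : ContinuousWithinAt f (Ioi t) t) : HasDerivWithinAt g (f t) (Ici t) t := by
  have hmeas : StronglyMeasurableAtFilter f (𝓝[>] t) := by
    refine ⟨Ioc 0 (t + 1), ?_, ?_⟩
    · exact mem_of_superset (Ioc_mem_nhdsGT (by linarith : t < t + 1)) (Ioc_subset_Ioc_left ht)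
    · exact ((intervalIntegrable_iff_integrableOn_Ioc_of_le (by linarith)).1
        (hf (t + 1) (by linarith))).aestronglyMeasurable
  have h := (intervalIntegral.integral_hasDerivWithinAt_right (s := Ici t) (t := Ioi t)
    (hf t ht) hmeas hc).const_add a
  exact h.congr (fun s hs => hg s (ht.trans hs)) (hg t ht)

/-! ### The time change -/

lemma IsRate.intervalIntegrable {μ : ℝ → ℝ} (hμ : IsRate μ) {s t : ℝ} (hs : 0 ≤ s) (ht : 0 ≤ t) :
    IntervalIntegrable μ volume s t :=
  (hμ.contDiff.continuousOn.mono fun _ hr => (le_min hs ht).trans hr.1).intervalIntegrable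

lemma IsRate.beta_lt {μ : ℝ → ℝ} (hμ : IsRate μ) {s t : ℝ} (hs : 0 ≤ s) (hst : s < t) :
    beta μ s < beta μ t := by
  have h := intervalIntegral.integral_add_adjacent_intervals
    (hμ.intervalIntegrable le_rfl hs) (hμ.intervalIntegrable hs (hs.trans hst.le))
  have h' : 0 < ∫ r in s..t, μ r :=
    intervalIntegral.intervalIntegral_pos_of_pos_on (hμ.intervalIntegrable hs (hs.trans hst.le))
      (fun r hr => hμ.pos r (hs.trans hr.1.le)) hst
  unfold beta
  linarith

lemma IsRate.beta_nonneg {μ : ℝ → ℝ} (hμ : IsRate μ) {t : ℝ} (ht : 0 ≤ t) : 0 ≤ beta μ t :=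
  intervalIntegral.integral_nonneg ht fun r hr => (hμ.pos r hr.1).le

/-- Strict growth of β keeps the approach one-sided, so right-continuity of the index process passes
to the time-changed path. -/
lemma IsRate.tendsto_beta {μ : ℝ → ℝ} (hμ : IsRate μ) {t : ℝ} (ht : 0 ≤ t) :
    Tendsto (beta μ) (𝓝[>] t) (𝓝[>] (beta μ t)) := by
  refine tendsto_nhdsWithin_of_tendsto_nhds_of_eventually_within _ ?_ ?_
  · have h := hasDerivWithinAt_Ici_of_eq_integral (f := μ) (g := beta μ) (a := 0)
      (fun s hs => hμ.intervalIntegrable le_rfl hs) (fun s _ => by simp [beta]) ht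
      ((hμ.contDiff.continuousOn t ht).mono fun _ hr => ht.trans (le_of_lt hr))
    exact h.continuousWithinAt.mono_left (nhdsWithin_mono _ Ioi_subset_Ici_self)
  · filter_upwards [self_mem_nhdsWithin] with s hs using hμ.beta_lt ht hs

/-! ### Comparison of the two flows along a fixed index path -/

section Path

variable {K N : ℕ} {Φ : Fin N → X K → ℝ} {κ : ℝ} {L : ℝ≥0} {m : ℝ → ℝ} {x : ℝ → Fin N}
  {q₀ p₀ ξ₀ : X K} {q p ξ : ℝ → X K}

/-- The index is constant just after t, so only the continuity of one gradient and of z is involved,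
even at a jump. -/
lemma continuousWithinAt_gradient_path (hL : ∀ j, LipschitzWith L (∇ (Φ j)))
    (hx : ∀ t, 0 ≤ t → ∀ᶠ s in 𝓝[>] t, x s = x t) {z : ℝ → X K} (hz : ContinuousOn z (Ici 0))
    {t : ℝ} (ht : 0 ≤ t) : ContinuousWithinAt (fun s => ∇ (Φ (x s)) (z s)) (Ioi t) t := by
  have hz' : ContinuousWithinAt z (Ioi t) t :=
    (hz t ht).mono fun _ hr => ht.trans (le_of_lt hr)
  have h : ContinuousWithinAt (fun s => ∇ (Φ (x t)) (z s)) (Ioi t) t :=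
    (hL (x t)).continuous.continuousAt.comp_continuousWithinAt hz'
  refine h.congr_of_eventuallyEq ?_ rfl
  filter_upwards [hx t ht] with s hs
  rw [hs]

lemma IsMomentumSolution.hasDerivWithinAt_q (h : IsMomentumSolution Φ m x q₀ p₀ q p) {t : ℝ}
    (ht : 0 ≤ t) : HasDerivWithinAt q (p t) (Ici t) t :=
  hasDerivWithinAt_Ici_of_eq_integral
    (fun s hs => (h.continuous_p.mono fun r hr => by
      rw [uIcc_of_le hs] at hr; exact hr.1).intervalIntegrable) h.eq_q ht
    ((h.continuous_p t ht).mono fun _ hr => ht.trans (le_of_lt hr))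

lemma IsMomentumSolution.hasDerivWithinAt_p (h : IsMomentumSolution Φ m x q₀ p₀ q p)
    (hL : ∀ j, LipschitzWith L (∇ (Φ j))) (hm : IsMass m)
    (hx : ∀ t, 0 ≤ t → ∀ᶠ s in 𝓝[>] t, x s = x t) {t : ℝ} (ht : 0 ≤ t) :
    HasDerivWithinAt p ((m t)⁻¹ • (-∇ (Φ (x t)) (q t) - p t)) (Ici t) t := by
  have hsub : Ioi t ⊆ Ici 0 := fun _ hr => ht.trans (le_of_lt hr)
  refine hasDerivWithinAt_Ici_of_eq_integral h.integrable h.eq_p ht ?_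
  refine ContinuousWithinAt.smul (f := fun s => (m s)⁻¹) ?_ (((continuousWithinAt_gradient_path hL hx h.continuous_q
    ht).neg).sub ((h.continuous_p t ht).mono hsub))
  exact (((hm.differentiable t ht).continuousWithinAt).mono hsub).inv₀ (hm.pos t ht).ne'

lemma IsGradientSolution.hasDerivWithinAt (h : IsGradientSolution Φ x ξ₀ ξ)
    (hL : ∀ j, LipschitzWith L (∇ (Φ j)))
    (hx : ∀ t, 0 ≤ t → ∀ᶠ s in 𝓝[>] t, x s = x t) {t : ℝ} (ht : 0 ≤ t) :
    HasDerivWithinAt ξ (-∇ (Φ (x t)) (ξ t)) (Ici t) t :=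
  hasDerivWithinAt_Ici_of_eq_integral h.integrable h.eq_ξ ht
    (continuousWithinAt_gradient_path hL hx h.continuous_ξ ht).neg

lemma IsMass.hasDerivWithinAt (hm : IsMass m) {t : ℝ} (ht : 0 < t) :
    HasDerivWithinAt m (deriv m t) (Ici t) t :=
  ((hm.differentiable t ht.le).differentiableAt (Ici_mem_nhds ht)).hasDerivAt.hasDerivWithinAt

/-- The variable `q + m p` satisfies a perturbed gradient flow equation. -/
lemma IsMomentumSolution.hasDerivWithinAt_add_smul (h : IsMomentumSolution Φ m x q₀ p₀ q p)
    (hL : ∀ j, LipschitzWith L (∇ (Φ j))) (hm : IsMass m)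
    (hx : ∀ t, 0 ≤ t → ∀ᶠ s in 𝓝[>] t, x s = x t) {t : ℝ} (ht : 0 < t) :
    HasDerivWithinAt (fun s => q s + m s • p s)
      (deriv m t • p t - ∇ (Φ (x t)) (q t)) (Ici t) t := by
  have h1 := (h.hasDerivWithinAt_q ht.le).add
    ((hm.hasDerivWithinAt ht).smul (h.hasDerivWithinAt_p hL hm hx ht.le))
  refine h1.congr_deriv ?_
  rw [smul_smul, mul_inv_cancel₀ (hm.pos t ht.le).ne', one_smul]
  abel

lemma IsMomentumSolution.continuousOn_add_smul (h : IsMomentumSolution Φ m x q₀ p₀ q p)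
    (hm : IsMass m) : ContinuousOn (fun s => q s + m s • p s) (Ici 0) :=
  h.continuous_q.add (hm.differentiable.continuousOn.smul h.continuous_p)

/-- Strong monotonicity, with an error from evaluating the gradient at a nearby point. -/
lemma inner_sub_gradient_le {f : X K → ℝ} (hL : LipschitzWith L (∇ f))
    (hκ : IsStronglyConvex f κ) (y z a v : X K) (d M : ℝ) (hM : 0 ≤ M) (hd : |d| ≤ M)
    (hy : y = a + M • v) :
    ⟪y - z, d • v - ∇ f a + ∇ f z⟫ ≤ -κ * ‖y - z‖ ^ 2 + ‖y - z‖ * ((L + 1) * (M * ‖v‖)) := by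
  have h1 := hκ.2 y z
  have hya : ‖y - a‖ = M * ‖v‖ := by
    rw [hy, add_sub_cancel_left, norm_smul, Real.norm_of_nonneg hM]
  have h2 : ‖∇ f y - ∇ f a‖ ≤ L * (M * ‖v‖) := by
    rw [← hya, ← dist_eq_norm, ← dist_eq_norm]; exact hL.dist_le_mul y a
  have h3 : ‖d • v‖ ≤ M * ‖v‖ := by
    rw [norm_smul]; exact mul_le_mul_of_nonneg_right hd (norm_nonneg _)
  have h4 : ⟪y - z, d • v + (∇ f y - ∇ f a)⟫ ≤ ‖y - z‖ * ((L + 1) * (M * ‖v‖)) := by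
    refine (real_inner_le_norm _ _).trans (mul_le_mul_of_nonneg_left ?_ (norm_nonneg _))
    linarith [norm_add_le (d • v) (∇ f y - ∇ f a)]
  have h5 : d • v - ∇ f a + ∇ f z = d • v + (∇ f y - ∇ f a) - (∇ f y - ∇ f z) := by abel
  rw [h5, inner_sub_right]
  linarith

/-- The scalar estimate behind the Lyapunov function `‖q + m p‖² + a m ‖p‖²`. -/
lemma lyapunov_estimate {κ l C M a u v : ℝ} (hκ : 0 < κ) (hM : 0 < M)
    (hM1 : M ≤ 1) (ha : 0 < a) (hal : 4 * a * l ^ 2 ≤ κ)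
    (hM2 : 8 * (l + 1) ^ 2 * M ≤ κ * a) (hM3 : 4 * (1 + 2 * l) * M ≤ 1) :
    2 * (-κ * u ^ 2 + u * ((l + 1) * (M * v)) + C * u)
        + a * (M * v ^ 2 + 2 * (-v ^ 2 + v * (C + l * (u + M * v))))
      ≤ -(min (κ / 2) (3 / 4)) * (u ^ 2 + a * (M * v ^ 2))
        + (2 * C ^ 2 / κ + 4 * a * C ^ 2) := by
  -- Young budget: of the dissipation 2κu², `e1`, `e3` and `e4` spend κ/2 each, leaving κ/2. Of
  -- 2av², `e2`, `e3`, `e4` and `e5` spend 1/4, 1/2, 1/4 and 1/4 of av², leaving 3/4.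
  have e1 : 2 * (C * u) ≤ κ / 2 * u ^ 2 + 2 * C ^ 2 / κ := by
    have : 0 ≤ (κ * u - 2 * C) ^ 2 / (2 * κ) := by positivity
    have e : (κ * u - 2 * C) ^ 2 / (2 * κ) = κ / 2 * u ^ 2 + 2 * C ^ 2 / κ - 2 * (C * u) := by
      field_simp; ring
    linarith
  have e2 : a * (2 * (v * C)) ≤ a / 4 * v ^ 2 + 4 * a * C ^ 2 := by
    nlinarith [mul_nonneg ha.le (sq_nonneg (v / 2 - 2 * C))]
  have e3 : a * (2 * (l * u * v)) ≤ κ / 2 * u ^ 2 + a / 2 * v ^ 2 := by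
    have h1 : 0 ≤ a * (2 * l * u - v) ^ 2 := by positivity
    have h2 := mul_le_mul_of_nonneg_right hal (sq_nonneg u)
    nlinarith
  have e4 : 2 * (u * ((l + 1) * (M * v))) ≤ κ / 2 * u ^ 2 + a / 4 * v ^ 2 := by
    have h1 : 0 ≤ (κ * u - 2 * (l + 1) * M * v) ^ 2 / (2 * κ) := by positivity
    have e : (κ * u - 2 * (l + 1) * M * v) ^ 2 / (2 * κ)
        = κ / 2 * u ^ 2 - 2 * (u * ((l + 1) * (M * v)))
          + (8 * (l + 1) ^ 2 * M) * M * v ^ 2 / (4 * κ) := by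
      field_simp; ring
    have h2 : (8 * (l + 1) ^ 2 * M) * M * v ^ 2 / (4 * κ) ≤ a / 4 * v ^ 2 := by
      rw [div_le_iff₀ (by positivity)]
      have h3 : (8 * (l + 1) ^ 2 * M) * M ≤ κ * a * 1 :=
        mul_le_mul hM2 hM1 hM.le (by positivity)
      have := mul_le_mul_of_nonneg_right h3 (sq_nonneg v)
      linarith
    linarith
  have e5 : a * ((1 + 2 * l) * M * v ^ 2) ≤ a / 4 * v ^ 2 := by
    have := mul_le_mul_of_nonneg_right hM3 (by positivity : 0 ≤ a * v ^ 2)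
    linarith
  have e6 : min (κ / 2) (3 / 4) * u ^ 2 ≤ κ / 2 * u ^ 2 :=
    mul_le_mul_of_nonneg_right (min_le_left _ _) (sq_nonneg u)
  have e7 : min (κ / 2) (3 / 4) * (a * (M * v ^ 2)) ≤ 3 / 4 * (a * v ^ 2) := by
    refine mul_le_mul (min_le_right _ _) ?_ (by positivity) (by norm_num)
    exact mul_le_mul_of_nonneg_left (mul_le_of_le_one_left (sq_nonneg v) hM1) ha.le
  linarith

/-- The momentum term `m p` vanishes in the limit. -/
lemma IsMomentumSolution.tendsto_mass_mul_norm (h : IsMomentumSolution Φ m x q₀ p₀ q p)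
    (hκ : 0 < κ) (hL : ∀ j, LipschitzWith L (∇ (Φ j)))
    (hconv : ∀ j, IsStronglyConvex (Φ j) κ) (hm : IsMass m)
    (hm' : ∀ t, 0 < t → |deriv m t| ≤ m t)
    (hx : ∀ t, 0 ≤ t → ∀ᶠ s in 𝓝[>] t, x s = x t) :
    Tendsto (fun t => m t * ‖p t‖) atTop (𝓝 0) := by
  obtain ⟨C, hC⟩ : ∃ C, ∀ j, ‖∇ (Φ j) 0‖ ≤ C :=
    ⟨∑ j, ‖∇ (Φ j) 0‖, fun j => Finset.single_le_sum (f := fun j => ‖∇ (Φ j) 0‖)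
      (fun _ _ => norm_nonneg _) (Finset.mem_univ j)⟩
  have hl : (0 : ℝ) ≤ L := L.2
  set l : ℝ := (L : ℝ) with hl_def
  -- Small enough for the cross term 2aluv to be absorbed; the +1 covers L = 0.
  set a : ℝ := κ / (4 * (l ^ 2 + 1)) with ha_def
  have ha : 0 < a := by positivity
  have hal : 4 * a * l ^ 2 ≤ κ := by
    have : 4 * a * (l ^ 2 + 1) = κ := by rw [ha_def]; field_simp
    linarith
  have hsmall : ∀ᶠ t in atTop, 0 < t ∧ m t ≤ 1 ∧ 8 * (l + 1) ^ 2 * m t ≤ κ * a ∧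
      4 * (1 + 2 * l) * m t ≤ 1 := by
    have hlim : ∀ b : ℝ, Tendsto (fun t => b * m t) atTop (𝓝 0) := fun b => by
      simpa using hm.tendsto_zero.const_mul b
    filter_upwards [eventually_gt_atTop 0, hm.tendsto_zero.eventually (ge_mem_nhds one_pos),
      (hlim (8 * (l + 1) ^ 2)).eventually (ge_mem_nhds (by positivity : 0 < κ * a)),
      (hlim (4 * (1 + 2 * l))).eventually (ge_mem_nhds one_pos)] with t h1 h2 h3 h4
    exact ⟨h1, h2, h3, h4⟩
  obtain ⟨T, hT⟩ := eventually_atTop.1 hsmall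
  have hT0 : 0 < T := (hT T le_rfl).1
  set y : ℝ → X K := fun s => q s + m s • p s with hy
  set V : ℝ → ℝ := fun s => ‖y s‖ ^ 2 + a * (m s * ‖p s‖ ^ 2) with hV
  set c : ℝ := min (κ / 2) (3 / 4) with hc_def
  have hc : 0 < c := lt_min (by positivity) (by norm_num)
  set D : ℝ := 2 * C ^ 2 / κ + 4 * a * C ^ 2 with hD_def
  have hD : 0 ≤ D := by positivity
  have hcont : ContinuousOn V (Ici 0) :=
    ((h.continuousOn_add_smul hm).norm.pow 2).add
      (continuousOn_const.mul (hm.differentiable.continuousOn.mul (h.continuous_p.norm.pow 2)))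
  have hder : ∀ t, T ≤ t → HasDerivWithinAt V
      (2 * ⟪y t, deriv m t • p t - ∇ (Φ (x t)) (q t)⟫
        + a * (deriv m t * ‖p t‖ ^ 2
          + m t * (2 * ⟪p t, (m t)⁻¹ • (-∇ (Φ (x t)) (q t) - p t)⟫))) (Ici t) t := by
    intro t ht
    have ht0 : 0 < t := hT0.trans_le ht
    exact ((h.hasDerivWithinAt_add_smul hL hm hx ht0).norm_sq).add
      (((hm.hasDerivWithinAt ht0).mul (h.hasDerivWithinAt_p hL hm hx ht0.le).norm_sq).const_mul a)
  have hbound : ∀ t, T ≤ t → 2 * ⟪y t, deriv m t • p t - ∇ (Φ (x t)) (q t)⟫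
        + a * (deriv m t * ‖p t‖ ^ 2
          + m t * (2 * ⟪p t, (m t)⁻¹ • (-∇ (Φ (x t)) (q t) - p t)⟫)) ≤ -c * V t + D := by
    intro t ht
    obtain ⟨ht0, hM1, hM2, hM3⟩ := hT t ht
    have hM : 0 < m t := hm.pos t ht0.le
    refine le_trans ?_ (lyapunov_estimate (C := C) (u := ‖y t‖) (v := ‖p t‖) hκ hM hM1 ha hal
      hM2 hM3)
    -- Monotonicity is tested against the origin; what remains is ∇Φ(0), bounded by C for every
    -- index.
    have b1 : ⟪y t, deriv m t • p t - ∇ (Φ (x t)) (q t)⟫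
        ≤ -κ * ‖y t‖ ^ 2 + ‖y t‖ * ((l + 1) * (m t * ‖p t‖)) + C * ‖y t‖ := by
      have h1 := inner_sub_gradient_le (hL (x t)) (hconv (x t)) (y t) 0 (q t) (p t)
        (deriv m t) (m t) hM.le (hm' t ht0) rfl
      rw [sub_zero, inner_add_right] at h1
      have h2 : -⟪y t, ∇ (Φ (x t)) 0⟫ ≤ ‖y t‖ * C := by
        refine (neg_le_abs _).trans ((abs_real_inner_le_norm _ _).trans ?_)
        exact mul_le_mul_of_nonneg_left (hC _) (norm_nonneg _)
      linarith
    have b2 : m t * (2 * ⟪p t, (m t)⁻¹ • (-∇ (Φ (x t)) (q t) - p t)⟫)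
        ≤ 2 * (-‖p t‖ ^ 2 + ‖p t‖ * (C + l * (‖y t‖ + m t * ‖p t‖))) := by
      -- The weight m in the Lyapunov function cancels the singular factor 1/m, leaving friction of
      -- full strength.
      have h1 : m t * (2 * ⟪p t, (m t)⁻¹ • (-∇ (Φ (x t)) (q t) - p t)⟫)
          = 2 * (-⟪p t, ∇ (Φ (x t)) (q t)⟫ - ‖p t‖ ^ 2) := by
        rw [real_inner_smul_right, inner_sub_right, inner_neg_right, real_inner_self_eq_norm_sq]
        field_simp
      have h2 : ‖∇ (Φ (x t)) (q t)‖ ≤ C + l * (‖y t‖ + m t * ‖p t‖) := by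
        have e1 : ‖∇ (Φ (x t)) (q t) - ∇ (Φ (x t)) 0‖ ≤ l * ‖q t‖ := by
          have := (hL (x t)).dist_le_mul (q t) 0
          rwa [dist_eq_norm, dist_eq_norm, sub_zero] at this
        have e2 : ‖q t‖ ≤ ‖y t‖ + m t * ‖p t‖ := by
          have e3 : q t = y t - m t • p t := by simp [hy]
          have e4 := norm_sub_le (y t) (m t • p t)
          rwa [← e3, norm_smul, Real.norm_of_nonneg hM.le] at e4
        have e5 := norm_sub_norm_le (∇ (Φ (x t)) (q t)) (∇ (Φ (x t)) 0)
        have e6 := mul_le_mul_of_nonneg_left e2 hl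
        linarith [hC (x t)]
      have h3 : -⟪p t, ∇ (Φ (x t)) (q t)⟫ ≤ ‖p t‖ * (C + l * (‖y t‖ + m t * ‖p t‖)) :=
        (neg_le_abs _).trans ((abs_real_inner_le_norm _ _).trans
          (mul_le_mul_of_nonneg_left h2 (norm_nonneg _)))
      linarith
    have b3 : deriv m t * ‖p t‖ ^ 2 ≤ m t * ‖p t‖ ^ 2 :=
      mul_le_mul_of_nonneg_right ((le_abs_self _).trans (hm' t ht0)) (sq_nonneg _)
    have b4 := mul_le_mul_of_nonneg_left (add_le_add b3 b2) ha.le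
    linarith
  have hVle : ∀ t, T ≤ t → V t ≤ V T + D / c := by
    intro t ht
    have h1 := le_exp_of_rightDeriv_le hc hD
      (fun s hs => (hcont s (hT0.le.trans hs)).mono (Ici_subset_Ici.2 hT0.le)) hder hbound ht
    have hVT : 0 ≤ V T := by have := (hm.pos T hT0.le).le; positivity
    have h2 : Real.exp (-c * (t - T)) ≤ 1 :=
      Real.exp_le_one_iff.2 (by nlinarith [mul_nonneg hc.le (sub_nonneg.2 ht)])
    nlinarith [mul_le_mul_of_nonneg_left h2 hVT]
  set B : ℝ := (V T + D / c) / a with hB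
  have hsq : ∀ t, T ≤ t → (m t * ‖p t‖) ^ 2 ≤ m t * B := by
    intro t ht
    have hM := (hm.pos t (hT0.le.trans ht)).le
    have h1 : m t * ‖p t‖ ^ 2 ≤ B := by
      rw [hB, le_div_iff₀ ha]
      have h2 := hVle t ht
      have h3 : V t = ‖y t‖ ^ 2 + a * (m t * ‖p t‖ ^ 2) := rfl
      nlinarith [sq_nonneg ‖y t‖]
    calc (m t * ‖p t‖) ^ 2 = m t * (m t * ‖p t‖ ^ 2) := by ring
      _ ≤ m t * B := mul_le_mul_of_nonneg_left h1 hM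
  have hlim : Tendsto (fun t => (m t * ‖p t‖) ^ 2) atTop (𝓝 0) := by
    have h1 : Tendsto (fun t => m t * B) atTop (𝓝 0) := by
      simpa using hm.tendsto_zero.mul_const B
    refine squeeze_zero' (Eventually.of_forall fun t => sq_nonneg _) ?_ h1
    filter_upwards [eventually_ge_atTop T] with t ht using hsq t ht
  have hsqrt := hlim.sqrt
  rw [Real.sqrt_zero] at hsqrt
  refine hsqrt.congr' ?_
  filter_upwards [eventually_ge_atTop T] with t ht
  exact Real.sqrt_sq (mul_nonneg (hm.pos t (hT0.le.trans ht)).le (norm_nonneg _))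

/-- Along every right-continuous index path the momentum dynamics and the gradient flow merge. -/
theorem tendsto_norm_sub_of_path (hκ : 0 < κ) (hL : ∀ j, LipschitzWith L (∇ (Φ j)))
    (hconv : ∀ j, IsStronglyConvex (Φ j) κ) (hm : IsMass m)
    (hm' : ∀ t, 0 < t → |deriv m t| ≤ m t)
    (hx : ∀ t, 0 ≤ t → ∀ᶠ s in 𝓝[>] t, x s = x t)
    (hqp : IsMomentumSolution Φ m x q₀ p₀ q p) (hξ : IsGradientSolution Φ x ξ₀ ξ) :
    Tendsto (fun t => ‖q t - ξ t‖) atTop (𝓝 0) := by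
  have hmp := hqp.tendsto_mass_mul_norm hκ hL hconv hm hm' hx
  set e : ℝ → X K := fun s => q s + m s • p s - ξ s with he
  have hcont : ContinuousOn (fun s => ‖e s‖ ^ 2) (Ici 0) :=
    ((hqp.continuousOn_add_smul hm).sub hξ.continuous_ξ).norm.pow 2
  have hesq : Tendsto (fun s => ‖e s‖ ^ 2) atTop (𝓝 0) := by
    -- Any positive starting time would do: at 0 the two-sided `deriv m` is not controlled.
    refine tendsto_zero_of_rightDeriv_le (T := 1) (c := κ)
      (V' := fun t => 2 * ⟪e t, deriv m t • p t - ∇ (Φ (x t)) (q t) - -∇ (Φ (x t)) (ξ t)⟫)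
      (δ := fun t => ((L + 1) * (m t * ‖p t‖)) ^ 2 / κ) hκ ?_ ?_ ?_ ?_ fun t => sq_nonneg _
    · exact fun t ht => (hcont t (zero_le_one.trans ht)).mono (Ici_subset_Ici.2 zero_le_one)
    · exact fun t ht => ((hqp.hasDerivWithinAt_add_smul hL hm hx (one_pos.trans_le ht)).sub
        (hξ.hasDerivWithinAt hL hx (zero_le_one.trans ht))).norm_sq
    · intro t ht
      have ht0 : 0 < t := one_pos.trans_le ht
      have h1 := inner_sub_gradient_le (hL (x t)) (hconv (x t)) (q t + m t • p t) (ξ t) (q t) (p t)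
        (deriv m t) (m t) (hm.pos t ht0.le).le (hm' t ht0) rfl
      simp only [sub_neg_eq_add]
      -- Young's inequality spends half of the contraction 2κ, leaving rate κ.
      have h2 : 2 * (‖e t‖ * ((L + 1) * (m t * ‖p t‖)))
          ≤ κ * ‖e t‖ ^ 2 + ((L + 1) * (m t * ‖p t‖)) ^ 2 / κ := by
        generalize (L + 1 : ℝ) * (m t * ‖p t‖) = w
        have h3 : 0 ≤ (κ * ‖e t‖ - w) ^ 2 / κ := by positivity
        have h4 : (κ * ‖e t‖ - w) ^ 2 / κ = κ * ‖e t‖ ^ 2 + w ^ 2 / κ - 2 * (‖e t‖ * w) := by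
          field_simp; ring
        linarith
      linarith
    · simpa using ((hmp.const_mul ((L : ℝ) + 1)).pow 2).div_const κ
  have hnorm : Tendsto (fun s => ‖e s‖) atTop (𝓝 0) := by
    simpa [Real.sqrt_sq (norm_nonneg _)] using hesq.sqrt
  refine squeeze_zero' (Eventually.of_forall fun t => norm_nonneg _) ?_
    (by simpa using hnorm.add hmp)
  filter_upwards [eventually_ge_atTop 0] with t ht
  have h1 : q t - ξ t = e t - m t • p t := by simp only [he]; abel
  rw [h1]
  refine (norm_sub_le _ _).trans_eq ?_
  rw [norm_smul, Real.norm_of_nonneg (hm.pos t ht).le]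

end Path

end SGMP

theorem mainTheorem1 {Ω : Type*} [MeasurableSpace Ω] (P : Measure Ω) [IsProbabilityMeasure P]
    {K N : ℕ} (Φ : Fin N → SGMP.X K → ℝ) (κ : ℝ) (L : ℝ≥0)
    (hΦ_contDiff : ∀ j, ContDiff ℝ 1 (Φ j))
    (hΦ_lipschitz : ∀ j, LipschitzWith L (∇ (Φ j)))
    (hΦ_convex : ∀ j, SGMP.IsStronglyConvex (Φ j) κ)
    (γ : ℝ) (hγ : 0 < γ) (i : ℝ → Ω → Fin N) (hi : SGMP.IsIndexProcess P γ i)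
    (m μ : ℝ → ℝ) (hm : SGMP.IsMass m) (hm_slow : SGMP.SlowMass m (min (κ / 4) (1 / 4)))
    (hμ : SGMP.IsRate μ) (hgrowth : SGMP.GrowthCondition P i m μ κ)
    (q₀ p₀ ξ₀ : SGMP.X K) (q p ξ : ℝ → Ω → SGMP.X K)
    (hqp : ∀ᵐ ω ∂P, SGMP.IsMomentumSolution Φ m (fun t => i (SGMP.beta μ t) ω) q₀ p₀
      (fun t => q t ω) (fun t => p t ω))
    (hξ : ∀ᵐ ω ∂P, SGMP.IsGradientSolution Φ (fun t => i (SGMP.beta μ t) ω) ξ₀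
      (fun t => ξ t ω)) :
    ∀ᵐ ω ∂P, Tendsto (fun t => ‖q t ω - ξ t ω‖) atTop (𝓝 0) := by

  filter_upwards [hqp, hξ] with ω hqpω hξω
  -- Positivity of κ is stored per index, so some index is needed; the path supplies one.
  have hκ : 0 < κ := (hΦ_convex (i 0 ω)).1
  refine SGMP.tendsto_norm_sub_of_path hκ hΦ_lipschitz hΦ_convex hm (fun t ht => ?_)
    (fun t ht => ?_) hqpω hξω
  · refine (hm_slow.deriv_le t ht).trans (mul_le_of_le_one_left (hm.pos t ht.le).le ?_)
    exact (min_le_right _ _).trans (by norm_num)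
  · exact (hμ.tendsto_beta ht).eventually (hi.right_continuous ω _ (hμ.beta_nonneg ht))
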